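/- Let $G$ be a compactly generated, totally disconnected, locally compact group that has no compact open normal subgroup. A Cayley--Abels graph for $G$ is a connected, locally finite graph (undirected, without loops or multiple edges) on which $G$ acts by graph automorphisms, transitively on the vertices, such that all vertex stabilizers are compact open subgroups of $G$; such a graph is regular. Let $\mathrm{mv}(G)$ denote the lowest possible degree of a Cayley--Abels graph for $G$. The scale function $s\colon G\to\mathbb{Z}_{>0}$ is defined by $$s(g)=\min\{\,|U:U\cap g^{-1}Ug| \;:\; U \text{ a compact open subgroup of } G\,\},$$ and $G$ is called uniscalar if $s(g)=1$ for all $g\in G$. If $\mathrm{mv}(G)=3$, then $G$ is not uniscalar, i.e. there is $g\in G$ with $s(g)\neq 1$. -/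

import Mathlib

universe u

namespace TDLC

/-- A topological group is compactly generated if some compact subset generates it
as an abstract group. -/
def IsCompactlyGenerated (G : Type u) [Group G] [TopologicalSpace G] : Prop :=
  ∃ C : Set G, IsCompact C ∧ Subgroup.closure C = ⊤

/-- A subgroup which is both compact and open. -/
def IsCompactOpen {G : Type u} [Group G] [TopologicalSpace G] (U : Subgroup G) : Prop :=
  IsCompact (U : Set G) ∧ IsOpen (U : Set G)

/-- `Γ` is a Cayley–Abels graph for `G`: the group `G` acts on the (simple, undirected)
connected, locally finite graph `Γ` by graph automorphisms, transitively on the vertices and with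
compact open vertex stabilizers. -/
structure IsCayleyAbelsGraph (G : Type u) [Group G] [TopologicalSpace G]
    {V : Type u} [MulAction G V] (Γ : SimpleGraph V) : Prop where
  adj_smul : ∀ (g : G) (v w : V), Γ.Adj v w → Γ.Adj (g • v) (g • w)
  vertexTransitive : MulAction.IsPretransitive G V
  connected : Γ.Connected
  locallyFinite : ∀ v : V, (Γ.neighborSet v).Finite
  stabilizer_compactOpen : ∀ v : V, IsCompactOpen (MulAction.stabilizer G v)

/-- The natural numbers that occur as the degree of a Cayley–Abels graph for `G`.
The vertex set of such a graph is in bijection with a coset space of `G`, so that it is enough to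
consider vertex sets in the universe of `G`. -/
def cayleyAbelsDegrees (G : Type u) [Group G] [TopologicalSpace G] : Set ℕ :=
  {d | ∃ (V : Type u) (_ : MulAction G V) (Γ : SimpleGraph V),
    IsCayleyAbelsGraph G Γ ∧ ∀ v : V, (Γ.neighborSet v).ncard = d}

/-- The lowest possible degree of a Cayley–Abels graph for `G`. -/
noncomputable def mv (G : Type u) [Group G] [TopologicalSpace G] : ℕ :=
  sInf (cayleyAbelsDegrees G)

/-- The scale function: `s(g)` is the minimum of the indices `|U : U ∩ g⁻¹ U g|` over all
compact open subgroups `U` of `G`. -/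
noncomputable def scale {G : Type u} [Group G] [TopologicalSpace G] (g : G) : ℕ :=
  sInf {n | ∃ U : Subgroup G, IsCompactOpen U ∧
    n = (U ⊓ U.map (MulAut.conj g⁻¹).toMonoidHom).relIndex U}

/-- `G` is uniscalar if its scale function is constant with value `1`. -/
def IsUniscalar (G : Type u) [Group G] [TopologicalSpace G] : Prop :=
  ∀ g : G, scale g = 1

end TDLC

namespace TDLC

open MulAction

/-! Suppose `G` is uniscalar and acts on a cubic Cayley–Abels graph. On the three neighbours of a
vertex, its stabilizer is transitive, trivial, or fixes exactly one point. Trivial local action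
makes the stabilizer normal, which is excluded. In the other two cases `G` acts on a digraph of
out-degree two with an arc-reversing involution: the arcs of the graph under non-backtracking
succession, or the vertices, using the perfect matching given by the fixed neighbours. That this is
a matching already needs uniscalarity (`IsUniscalar.map_conj_le`).

For such a digraph, `IsReversibleDigraph.not_isUniscalar` produces a compact open normal subgroup.
If transitivity on directed paths fails at some length, the stabilizer of a path acts trivially, so
the kernel of the action is open. Otherwise the endpoints of the `n`-paths from a vertex lie in one
orbit of its stabilizer, and uniscalarity bounds its size independently of `n`. Bounded growth makes
descendant sets stabilise; the vertices with eventually equal descendants form finite classes, and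
the subgroup preserving every class is normal, open and compact. -/

lemma le_map_conj_pow {G : Type*} [Group G] {U : Subgroup G} {g : G}
    (h : U ≤ U.map (MulAut.conj g).toMonoidHom) (n : ℕ) : U ≤ U.map (MulAut.conj (g ^ n)).toMonoidHom := by
  induction n with
  | zero => intro x hx; exact ⟨x, hx, by simp⟩
  | succ n ih =>
    intro x hx
    obtain ⟨y, hy, rfl⟩ := ih hx
    obtain ⟨z, hz, rfl⟩ := h hy
    exact ⟨z, hz, by simp [pow_succ, mul_assoc]⟩

/-! ### Compact open subgroups and uniscalarity. -/

section CompactOpen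

variable {G : Type u} [Group G] [TopologicalSpace G] [IsTopologicalGroup G]

lemma isCompactOpen_of_isOpen_of_subset {N : Subgroup G} (ho : IsOpen (N : Set G)) {C : Set G}
    (hC : IsCompact C) (h : (N : Set G) ⊆ C) : IsCompactOpen N :=
  ⟨hC.of_isClosed_subset (N.isClosed_of_isOpen ho) h, ho⟩

lemma IsCompactOpen.relIndex_ne_zero {U V : Subgroup G} (hU : IsCompactOpen U)
    (hV : IsCompactOpen V) : V.relIndex U ≠ 0 := by
  have : CompactSpace U := isCompact_iff_compactSpace.mp hU.1
  have ho : IsOpen (V.subgroupOf U : Set U) := hV.2.preimage continuous_subtype_val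
  have := Subgroup.quotient_finite_of_isOpen _ ho
  exact Subgroup.index_ne_zero_of_finite

lemma IsCompactOpen.map_conj {U : Subgroup G} (hU : IsCompactOpen U) (g : G) :
    IsCompactOpen (U.map (MulAut.conj g).toMonoidHom) := by
  have h : ((U.map (MulAut.conj g).toMonoidHom : Subgroup G) : Set G) =
      ((Homeomorph.mulLeft g).trans (Homeomorph.mulRight g⁻¹)) '' (U : Set G) := by
    ext x
    simp
  constructor
  · rw [h]
    exact hU.1.image (Homeomorph.continuous _)
  · rw [h]
    exact (Homeomorph.isOpenMap _) _ hU.2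

/-- In a uniscalar group, the conjugates of a compact open subgroup by the powers of an element
are uniformly commensurate to it. -/
lemma IsUniscalar.exists_relIndex_le (h : IsUniscalar G) {V : Subgroup G} (hV : IsCompactOpen V)
    (g : G) : ∃ M, ∀ n : ℕ, (V.map (MulAut.conj (g ^ n)).toMonoidHom).relIndex V ≤ M := by
  -- The scale conjugates by the inverse of its argument, so `g⁻¹` yields a minimising `U` contained
  -- in `g U g⁻¹`.
  have hs := h g⁻¹
  have hne : {n | ∃ U : Subgroup G, IsCompactOpen U ∧
      n = (U ⊓ U.map (MulAut.conj g⁻¹⁻¹).toMonoidHom).relIndex U}.Nonempty :=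
    ⟨_, V, hV, rfl⟩
  obtain ⟨U, hU, h1⟩ := Nat.sInf_mem hne
  have hUg : U ≤ U.map (MulAut.conj g).toMonoidHom := by
    have h2 : (U ⊓ U.map (MulAut.conj g⁻¹⁻¹).toMonoidHom).relIndex U = 1 := h1.symm.trans hs
    rw [Subgroup.relIndex_eq_one, inv_inv] at h2
    exact h2.trans inf_le_right
  -- Pass from `V` to `U ⊓ V`, which lies in every `g ^ n U g ^ (-n)`; there the index of the
  -- conjugate of `V` is that of `V` in `U`.
  refine ⟨V.relIndex U * U.relIndex V, fun n => ?_⟩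
  set Vn := V.map (MulAut.conj (g ^ n)).toMonoidHom with hVn
  have e : Vn.relIndex (U.map (MulAut.conj (g ^ n)).toMonoidHom) = V.relIndex U :=
    Subgroup.relIndex_map_map_of_injective _ _ (MulAut.conj (g ^ n)).injective
  have hne0 : Vn.relIndex (U.map (MulAut.conj (g ^ n)).toMonoidHom) ≠ 0 :=
    e ▸ hU.relIndex_ne_zero hV
  have h3 : Vn.relIndex (U ⊓ V) ≤ V.relIndex U :=
    e ▸ Subgroup.relIndex_le_of_le_right (inf_le_left.trans (le_map_conj_pow hUg n)) hne0
  calc Vn.relIndex V ≤ (Vn ⊓ U).relIndex V :=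
        Subgroup.relIndex_le_of_le_left inf_le_left
          (Subgroup.relIndex_inf_ne_zero (hV.relIndex_ne_zero (hV.map_conj _))
            (hV.relIndex_ne_zero hU))
    _ = Vn.relIndex (U ⊓ V) * U.relIndex V := (Subgroup.relIndex_inf_mul_relIndex _ _ _).symm
    _ ≤ _ := Nat.mul_le_mul_right _ h3

/-- In a uniscalar group, no compact open subgroup is properly contained in a conjugate. -/
lemma IsUniscalar.map_conj_le (h : IsUniscalar G) {V : Subgroup G} (hV : IsCompactOpen V)
    {g : G} (hg : V ≤ V.map (MulAut.conj g).toMonoidHom) :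
    V.map (MulAut.conj g).toMonoidHom ≤ V := by
  by_contra hlt
  set k := V.relIndex (V.map (MulAut.conj g).toMonoidHom) with hk
  have hk2 : 2 ≤ k := by
    have h0 : k ≠ 0 := (hV.map_conj g).relIndex_ne_zero hV
    have h1 : k ≠ 1 := fun h1 => hlt (Subgroup.relIndex_eq_one.mp h1)
    omega
  have hmm : ∀ a b : G, (V.map (MulAut.conj b).toMonoidHom).map (MulAut.conj a).toMonoidHom =
      V.map (MulAut.conj (a * b)).toMonoidHom := by
    intro a b
    rw [Subgroup.map_map]
    congr 1
    ext x
    simp [mul_assoc]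
  have hpow : ∀ n : ℕ, V.relIndex (V.map (MulAut.conj (g ^ n)).toMonoidHom) = k ^ n := by
    intro n
    induction n with
    | zero =>
      rw [pow_zero, pow_zero, Subgroup.relIndex_eq_one]
      rintro _ ⟨x, hx, rfl⟩
      simpa using hx
    | succ n ih =>
      have hle : V.map (MulAut.conj (g ^ n)).toMonoidHom ≤
          V.map (MulAut.conj (g ^ (n + 1))).toMonoidHom := by
        rw [pow_succ, ← hmm]
        exact Subgroup.map_mono hg
      rw [← Subgroup.relIndex_mul_relIndex _ _ _ (le_map_conj_pow hg n) hle, ih, pow_succ k]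
      congr 1
      rw [pow_succ, ← hmm]
      exact Subgroup.relIndex_map_map_of_injective _ _ (MulAut.conj (g ^ n)).injective
  -- The index `k ^ n` is bounded by `M` for all `n`; taking `n = M` contradicts `M < k ^ M`.
  obtain ⟨M, hM⟩ := h.exists_relIndex_le hV g⁻¹
  have hle := hM M
  have e := Subgroup.relIndex_map_map_of_injective (f := (MulAut.conj (g ^ M)).toMonoidHom)
    (V.map (MulAut.conj (g⁻¹ ^ M)).toMonoidHom) V (MulAut.conj (g ^ M)).injective
  have e2 := hmm (g ^ M) (g⁻¹ ^ M)
  have e3 : V.map (MulAut.conj (1 : G)).toMonoidHom = V := by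
    ext x
    simp
  rw [inv_pow, mul_inv_cancel, e3] at e2
  have e4 : k ^ M = (V.map (MulAut.conj (g⁻¹ ^ M)).toMonoidHom).relIndex V := by
    rw [← e, ← hpow M, inv_pow]
    congr 1
    exact e2.symm
  have := Nat.lt_pow_self hk2 (n := M)
  omega

/-- By orbit–stabilizer, the orbit size is the index of a conjugate by `g ^ n`, which is uniformly
bounded. -/
lemma IsUniscalar.exists_ncard_orbit_le (h : IsUniscalar G) {X : Type*} [MulAction G X]
    (hc : ∀ x : X, IsCompactOpen (stabilizer G x)) (g : G) (x : X) :
    ∃ M, ∀ n : ℕ, (orbit (stabilizer G x) (g ^ n • x)).Finite ∧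
      (orbit (stabilizer G x) (g ^ n • x)).ncard ≤ M := by
  obtain ⟨M, hM⟩ := h.exists_relIndex_le (hc x) g
  refine ⟨M, fun n => ?_⟩
  have e : (orbit (stabilizer G x) (g ^ n • x)).ncard =
      (stabilizer G (g ^ n • x)).relIndex (stabilizer G x) := by
    rw [← index_stabilizer]
    rfl
  refine ⟨Set.finite_of_ncard_ne_zero ?_, ?_⟩
  · rw [e]
    exact (hc _).relIndex_ne_zero (hc _)
  · rw [e, stabilizer_smul_eq_stabilizer_map_conj]
    exact hM n

end CompactOpen

/-! ### Directed paths and their endpoints. -/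

section Arcs

/-- The first `n + 1` values of `p` form a directed path for the relation `R`. -/
def IsArc {X : Type*} (R : X → X → Prop) (n : ℕ) (p : ℕ → X) : Prop :=
  ∀ i < n, R (p i) (p (i + 1))

/-- The endpoints of the directed paths of length `n` that start at `x`. -/
def arcEnds {X : Type*} (R : X → X → Prop) (n : ℕ) (x : X) : Set X :=
  {z | ∃ p, IsArc R n p ∧ p 0 = x ∧ p n = z}

variable {X : Type*} {R : X → X → Prop}

lemma IsArc.cons {n : ℕ} {p : ℕ → X} {x : X} (hp : IsArc R n p) (hx : R x (p 0)) :
    IsArc R (n + 1) (fun i => Nat.casesOn i x p) := by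
  rintro (_ | i) hi
  · exact hx
  · exact hp i (by omega)

lemma IsArc.update {n : ℕ} {p : ℕ → X} {y : X} (hp : IsArc R n p) (hy : R (p n) y) :
    IsArc R (n + 1) (Function.update p (n + 1) y) := by
  intro i hi
  rw [Function.update_of_ne (by omega)]
  rcases Nat.lt_succ_iff_lt_or_eq.mp hi with h | rfl
  · rw [Function.update_of_ne (by omega)]
    exact hp i h
  · rwa [Function.update_self]

lemma IsArc.tail {n : ℕ} {p : ℕ → X} (hp : IsArc R (n + 1) p) :
    IsArc R n (fun i => p (i + 1)) :=
  fun i hi => hp (i + 1) (by omega)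

lemma mem_arcEnds_succ_iff {n : ℕ} {x z : X} :
    z ∈ arcEnds R (n + 1) x ↔ ∃ y, R x y ∧ z ∈ arcEnds R n y := by
  constructor
  · rintro ⟨p, hp, rfl, rfl⟩
    exact ⟨p 1, hp 0 (by omega), _, hp.tail, rfl, rfl⟩
  · rintro ⟨y, hy, p, hp, rfl, rfl⟩
    exact ⟨_, hp.cons hy, rfl, rfl⟩

lemma mem_arcEnds_succ_iff' {n : ℕ} {x z : X} :
    z ∈ arcEnds R (n + 1) x ↔ ∃ y ∈ arcEnds R n x, R y z := by
  constructor
  · rintro ⟨p, hp, rfl, rfl⟩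
    exact ⟨p n, ⟨p, fun i hi => hp i (by omega), rfl, rfl⟩, hp n (by omega)⟩
  · rintro ⟨y, ⟨p, hp, rfl, rfl⟩, hy⟩
    exact ⟨_, hp.update hy, Function.update_of_ne (by omega) _ _, Function.update_self _ _ _⟩

lemma arcEnds_congr_of_le {x y : X} {m n : ℕ} (hmn : m ≤ n)
    (h : arcEnds R m x = arcEnds R m y) : arcEnds R n x = arcEnds R n y := by
  induction n, hmn using Nat.le_induction with
  | base => exact h
  | succ n _ ih =>
    ext z
    rw [mem_arcEnds_succ_iff', mem_arcEnds_succ_iff', ih]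

end Arcs

/-- A group acts transitively on a digraph of out-degree two, and commutes with an involution
that reverses all arcs and, together with the arcs, connects the digraph. -/
structure IsReversibleDigraph (G : Type*) [Group G] {X : Type*} [MulAction G X]
    (R : X → X → Prop) (τ : X → X) : Prop where
  transitive : IsPretransitive G X
  rel_smul : ∀ (g : G) (x y : X), R x y → R (g • x) (g • y)
  ncard_out : ∀ x, {y | R x y}.ncard = 2
  rev_smul : ∀ (g : G) (x : X), τ (g • x) = g • τ x
  rev_rev : ∀ x, τ (τ x) = x
  rel_rev : ∀ x y, R x y → R (τ y) (τ x)
  connected : ∀ S : Set X, S.Nonempty → (∀ x ∈ S, τ x ∈ S) → (∀ x ∈ S, ∀ y, R x y → y ∈ S) →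
    ∀ x, x ∈ S

namespace IsReversibleDigraph

/-! ### Path transitivity and descendant classes in reversible digraphs. -/

section Algebra

variable {G : Type*} [Group G] {X : Type*} [MulAction G X] {R : X → X → Prop} {τ : X → X}

lemma smul_arc (h : IsReversibleDigraph G R τ) {n : ℕ} {p : ℕ → X} (hp : IsArc R n p) (g : G) :
    IsArc R n (fun i => g • p i) :=
  fun i hi => h.rel_smul g _ _ (hp i hi)

lemma rev_arc (h : IsReversibleDigraph G R τ) {n : ℕ} {p : ℕ → X} (hp : IsArc R n p) :
    IsArc R n (fun i => τ (p (n - i))) := by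
  intro i hi
  have := h.rel_rev _ _ (hp (n - (i + 1)) (by omega))
  rwa [show n - (i + 1) + 1 = n - i by omega] at this

lemma exists_rel (h : IsReversibleDigraph G R τ) (x : X) : ∃ y, R x y := by
  have : {y | R x y}.Nonempty := Set.nonempty_of_ncard_ne_zero (by rw [h.ncard_out]; omega)
  exact this

lemma isArc_pow_smul (h : IsReversibleDigraph G R τ) {x : X} {g : G} (hg : R x (g • x)) (n : ℕ) :
    IsArc R n (fun i => g ^ i • x) := by
  intro i _
  have := h.rel_smul (g ^ i) _ _ hg
  rwa [smul_smul, ← pow_succ] at this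

lemma exists_isArc (h : IsReversibleDigraph G R τ) (x : X) (n : ℕ) :
    ∃ p, IsArc R n p ∧ p 0 = x := by
  have := h.transitive
  obtain ⟨y, hy⟩ := h.exists_rel x
  obtain ⟨g, rfl⟩ := exists_smul_eq G x y
  exact ⟨_, h.isArc_pow_smul hy n, by simp⟩

/-- If an element fixing a path of length `n` always fixes the possible continuations, then it
fixes everything. -/
lemma smul_eq_of_forall_arc (h : IsReversibleDigraph G R τ) {n : ℕ} {k : G}
    (hk : ∀ p, IsArc R n p → (∀ i ≤ n, k • p i = p i) → ∀ y, R (p n) y → k • y = y)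
    {p : ℕ → X} (hp : IsArc R n p) (hpk : ∀ i ≤ n, k • p i = p i) (x : X) : k • x = x := by
  -- Pointwise fixed paths can be shifted forward and reversed, so their initial vertices form a set
  -- to which connectedness applies.
  let good : Set (ℕ → X) := {q | IsArc R n q ∧ ∀ i ≤ n, k • q i = q i}
  have hshift : ∀ q ∈ good, ∀ y, R (q n) y →
      (fun i => Function.update q (n + 1) y (i + 1)) ∈ good := by
    rintro q ⟨hq, hqk⟩ y hy
    refine ⟨(hq.update hy).tail, fun i hi => ?_⟩
    rcases Nat.lt_or_eq_of_le hi with hi | rfl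
    · have : Function.update q (n + 1) y (i + 1) = q (i + 1) :=
        Function.update_of_ne (by omega) _ _
      simp only [this]
      exact hqk _ hi
    · simp only [Function.update_self]
      exact hk q hq hqk y hy
  have hrev : ∀ q ∈ good, (fun i => τ (q (n - i))) ∈ good := by
    rintro q ⟨hq, hqk⟩
    refine ⟨h.rev_arc hq, fun i _ => ?_⟩
    rw [← h.rev_smul, hqk _ (by omega)]
  have hstart : ∀ j ≤ n, ∀ q ∈ good, ∃ r ∈ good, r 0 = q j := by
    intro j
    induction j with
    | zero => exact fun _ q hq => ⟨q, hq, rfl⟩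
    | succ j ih =>
      intro hj q hq
      obtain ⟨y, hy⟩ := h.exists_rel (q n)
      obtain ⟨r, hr, hr0⟩ := ih (by omega) _ (hshift q hq y hy)
      exact ⟨r, hr, hr0.trans (Function.update_of_ne (by omega) _ _)⟩
  have hmem : ∀ x, x ∈ {x | ∃ q ∈ good, q 0 = x} := by
    have hτ : ∀ x ∈ {x | ∃ q ∈ good, q 0 = x}, τ x ∈ {x | ∃ q ∈ good, q 0 = x} := by
      rintro _ ⟨q, hq, rfl⟩
      obtain ⟨r, hr, hr0⟩ := hstart n le_rfl _ (hrev q hq)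
      exact ⟨r, hr, by simpa using hr0⟩
    refine h.connected _ ⟨_, p, ⟨hp, hpk⟩, rfl⟩ hτ ?_
    intro x hx y hy
    obtain ⟨q, hq, hq0⟩ := hτ x hx
    -- Reversing a good path from `τ x` gives one ending at `x`, which can then be continued to `y`.
    have hend := hrev q hq
    have hlast : τ (q (n - n)) = x := by simp [hq0, h.rev_rev]
    obtain ⟨r, hr, hr0⟩ := hstart n le_rfl _ (hshift _ hend y (by simpa only [hlast] using hy))
    exact ⟨r, hr, by simpa using hr0⟩
  obtain ⟨q, hq, rfl⟩ := hmem x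
  exact hq.2 0 (Nat.zero_le n)

/-- Transitivity on the directed paths of length `n`. -/
def ArcTransitive (G : Type*) [Group G] {X : Type*} [MulAction G X] (R : X → X → Prop)
    (n : ℕ) : Prop :=
  ∀ p q, IsArc R n p → IsArc R n q → ∃ g : G, ∀ i ≤ n, g • p i = q i

/-- Since the out-degree is two, `k` swaps the two continuations of `p`, so transitivity on
`n`-paths extends by one step. -/
lemma arcTransitive_succ (h : IsReversibleDigraph G R τ) {n : ℕ} (hn : ArcTransitive G R n)
    {p : ℕ → X} (hp : IsArc R n p) {k : G} (hk : ∀ i ≤ n, k • p i = p i) {y : X}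
    (hy : R (p n) y) (hky : k • y ≠ y) : ArcTransitive G R (n + 1) := by
  have hout : ∀ z, R (p n) z → z = y ∨ z = k • y := by
    obtain ⟨a, b, -, hab⟩ := Set.ncard_eq_two.mp (h.ncard_out (p n))
    have hy' : R (p n) (k • y) := by
      have := h.rel_smul k _ _ hy
      rwa [hk n le_rfl] at this
    have key : ∀ z, R (p n) z ↔ z = a ∨ z = b := fun z => by
      have : z ∈ {y | R (p n) y} ↔ z ∈ ({a, b} : Set X) := by rw [hab]
      simpa using this
    intro z hz
    rw [key] at hy hy' hz
    grind
  have hto : ∀ q, IsArc R (n + 1) q → ∃ g : G, (∀ i ≤ n, g • q i = p i) ∧ g • q (n + 1) = y := by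
    intro q hq
    obtain ⟨g, hg⟩ := hn q p (fun i hi => hq i (by omega)) hp
    have hr := h.rel_smul g _ _ (hq n (by omega))
    rw [hg n le_rfl] at hr
    rcases hout _ hr with e | e
    · exact ⟨g, hg, e⟩
    · refine ⟨k⁻¹ * g, fun i hi => ?_, ?_⟩
      · rw [mul_smul, hg i hi, inv_smul_eq_iff, hk i hi]
      · rw [mul_smul, e, inv_smul_smul]
  intro q r hq hr
  obtain ⟨a, ha, ha'⟩ := hto q hq
  obtain ⟨b, hb, hb'⟩ := hto r hr
  refine ⟨b⁻¹ * a, fun i hi => ?_⟩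
  rw [mul_smul, inv_smul_eq_iff]
  rcases Nat.lt_or_eq_of_le hi with hi | rfl
  · rw [ha i (by omega), hb i (by omega)]
  · rw [ha', hb']

lemma smul_mem_arcEnds (h : IsReversibleDigraph G R τ) (g : G) {n : ℕ} {x z : X}
    (hz : z ∈ arcEnds R n x) : g • z ∈ arcEnds R n (g • x) := by
  obtain ⟨p, hp, rfl, rfl⟩ := hz
  exact ⟨_, h.smul_arc hp g, rfl, rfl⟩

lemma arcEnds_smul (h : IsReversibleDigraph G R τ) (g : G) (n : ℕ) (x : X) :
    arcEnds R n (g • x) = (g • ·) '' arcEnds R n x := by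
  ext z
  constructor
  · intro hz
    refine ⟨g⁻¹ • z, ?_, smul_inv_smul g z⟩
    simpa using h.smul_mem_arcEnds g⁻¹ hz
  · rintro ⟨w, hw, rfl⟩
    exact h.smul_mem_arcEnds g hw

lemma rev_mem_arcEnds (h : IsReversibleDigraph G R τ) {n : ℕ} {x z : X}
    (hz : z ∈ arcEnds R n x) : τ x ∈ arcEnds R n (τ z) := by
  obtain ⟨p, hp, rfl, rfl⟩ := hz
  exact ⟨_, h.rev_arc hp, by simp, by simp⟩

lemma ncard_arcEnds_smul (h : IsReversibleDigraph G R τ) (g : G) (n : ℕ) (x : X) :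
    (arcEnds R n (g • x)).ncard = (arcEnds R n x).ncard := by
  rw [h.arcEnds_smul, Set.ncard_image_of_injective _ (MulAction.injective g)]

/-- Two vertices are eventually equivalent if they have the same descendants from some
distance on. -/
def eventualSetoid {X : Type*} (R : X → X → Prop) : Setoid X where
  r x y := ∃ n, arcEnds R n x = arcEnds R n y
  iseqv :=
    { refl := fun _ => ⟨0, rfl⟩
      symm := fun ⟨n, hn⟩ => ⟨n, hn.symm⟩
      trans := fun ⟨m, hm⟩ ⟨n, hn⟩ => ⟨max m n,
        (arcEnds_congr_of_le (le_max_left m n) hm).trans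
          (arcEnds_congr_of_le (le_max_right m n) hn)⟩ }

lemma eventualSetoid_smul (h : IsReversibleDigraph G R τ) (g : G) {x y : X}
    (hxy : eventualSetoid R x y) : eventualSetoid R (g • x) (g • y) := by
  obtain ⟨n, hn⟩ := hxy
  exact ⟨n, by rw [h.arcEnds_smul, h.arcEnds_smul, hn]⟩

/-- The subgroup of all elements that preserve each class of eventual equivalence. -/
def classKernel (G : Type*) [Group G] {X : Type*} [MulAction G X] (R : X → X → Prop) :
    Subgroup G where
  carrier := {k | ∀ y, eventualSetoid R (k • y) y}
  one_mem' y := by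
    rw [one_smul]
  mul_mem' {a b} ha hb y := by
    rw [mul_smul]
    exact (eventualSetoid R).trans (ha _) (hb _)
  inv_mem' {a} ha y := by
    have := ha (a⁻¹ • y)
    rw [smul_inv_smul] at this
    exact (eventualSetoid R).symm this

lemma classKernel_normal (h : IsReversibleDigraph G R τ) : (classKernel G R).Normal where
  conj_mem k hk g y := by
    have := h.eventualSetoid_smul g (hk (g⁻¹ • y))
    rwa [smul_inv_smul, smul_smul, smul_smul] at this

/-- Bounded numbers of descendants stabilise. -/
lemma exists_arcEnds_succ_eq (h : IsReversibleDigraph G R τ) {M : ℕ}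
    (hM : ∀ n x, (arcEnds R n x).Finite ∧ (arcEnds R n x).ncard ≤ M) [Nonempty X] :
    ∃ m, ∀ n ≥ m, ∀ x y, R x y → arcEnds R (n + 1) x = arcEnds R n y := by
  have := h.transitive
  obtain ⟨x₀⟩ := ‹Nonempty X›
  have hc : ∀ n x, (arcEnds R n x).ncard = (arcEnds R n x₀).ncard := by
    intro n x
    obtain ⟨g, rfl⟩ := exists_smul_eq G x₀ x
    exact h.ncard_arcEnds_smul g n x₀
  have hsub : ∀ n x y, R x y → arcEnds R n y ⊆ arcEnds R (n + 1) x :=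
    fun n x y hxy z hz => mem_arcEnds_succ_iff.mpr ⟨y, hxy, hz⟩
  have hmono : Monotone fun n => (arcEnds R n x₀).ncard := by
    refine monotone_nat_of_le_succ fun n => ?_
    obtain ⟨y, hy⟩ := h.exists_rel x₀
    rw [← hc n y]
    exact Set.ncard_le_ncard (hsub n _ _ hy) (hM _ _).1
  -- From a length where the bounded, monotone count is maximal, the inclusions `hsub` are
  -- equalities.
  obtain ⟨m, hm⟩ : ∃ m, ∀ n, (arcEnds R n x₀).ncard ≤ (arcEnds R m x₀).ncard := by
    have hb : BddAbove (Set.range fun n => (arcEnds R n x₀).ncard) :=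
      ⟨M, by rintro _ ⟨n, rfl⟩; exact (hM n x₀).2⟩
    obtain ⟨m, hm⟩ := Nat.sSup_mem (Set.range_nonempty _) hb
    exact ⟨m, fun n => (le_csSup hb ⟨n, rfl⟩).trans hm.ge⟩
  refine ⟨m, fun n hn x y hxy => (Set.eq_of_subset_of_ncard_le (hsub n x y hxy) ?_ (hM _ _).1).symm⟩
  rw [hc, hc n]
  exact (hm _).trans (hmono hn)

/-- Once descendants have stabilised, whether `k` preserves the class of a vertex passes both ways
along arcs, so it spreads from the fixed vertex. -/
lemma stabilizer_le_classKernel (h : IsReversibleDigraph G R τ) {m : ℕ}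
    (hm : ∀ n ≥ m, ∀ x y, R x y → arcEnds R (n + 1) x = arcEnds R n y) (x : X) :
    stabilizer G x ≤ classKernel G R := by
  intro k hk
  have hout : ∀ x y, R x y → (eventualSetoid R (k • x) x ↔ eventualSetoid R (k • y) y) := by
    intro x y hxy
    have hkxy := h.rel_smul k _ _ hxy
    constructor
    · rintro ⟨n, hn⟩
      refine ⟨max m n, ?_⟩
      rw [← hm _ (le_max_left m n) _ _ hkxy, ← hm _ (le_max_left m n) _ _ hxy]
      exact arcEnds_congr_of_le ((le_max_right m n).trans (Nat.le_succ _)) hn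
    · rintro ⟨n, hn⟩
      refine ⟨max m n + 1, ?_⟩
      rw [hm _ (le_max_left m n) _ _ hkxy, hm _ (le_max_left m n) _ _ hxy]
      exact arcEnds_congr_of_le (le_max_right m n) hn
  have hfix : ∀ z, k • z = z → eventualSetoid R (k • z) z := fun z hz => by
    rw [hz]
  -- Recording `τ z` as well makes the set closed under `τ`; the arc from `z` to `y` is used
  -- forwards, and its reversal backwards.
  have key := h.connected
    {z | eventualSetoid R (k • z) z ∧ eventualSetoid R (k • τ z) (τ z)}
    ⟨x, hfix x hk, hfix _ (by rw [← h.rev_smul, hk])⟩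
    (fun z hz => ⟨hz.2, by rw [h.rev_rev]; exact hz.1⟩)
    (fun z hz y hzy => ⟨(hout _ _ hzy).mp hz.1, (hout _ _ (h.rel_rev _ _ hzy)).mpr hz.2⟩)
  exact fun y => (key y).1

/-- Any `M + 1` members of a class share a descendant at a common distance; reversal turns them into
`M + 1` descendants of a single vertex. -/
lemma finite_eventual_class (h : IsReversibleDigraph G R τ) {M : ℕ}
    (hM : ∀ n x, (arcEnds R n x).Finite ∧ (arcEnds R n x).ncard ≤ M) (x : X) :
    {y | eventualSetoid R y x}.Finite := by
  by_contra hinf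
  obtain ⟨t, ht, hcard⟩ := Set.Infinite.exists_subset_card_eq hinf (M + 1)
  choose! n hn using fun y (hy : y ∈ t) => (ht hy : ∃ n, arcEnds R n y = arcEnds R n x)
  obtain ⟨p, hp, hp0⟩ := h.exists_isArc x (t.sup n)
  have hz : p (t.sup n) ∈ arcEnds R (t.sup n) x := ⟨p, hp, hp0, rfl⟩
  have hsub : τ '' (t : Set X) ⊆ arcEnds R (t.sup n) (τ (p (t.sup n))) := by
    rintro _ ⟨y, hy, rfl⟩
    apply h.rev_mem_arcEnds
    rwa [arcEnds_congr_of_le (Finset.le_sup hy) (hn y hy)]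
  have hinj : Function.Injective τ := (show Function.Involutive τ from h.rev_rev).injective
  have h1 := Set.ncard_le_ncard hsub (hM _ _).1
  rw [Set.ncard_image_of_injective _ hinj, Set.ncard_coe_finset, hcard] at h1
  have := (hM (t.sup n) (τ (p (t.sup n)))).2
  omega

end Algebra

/-! ### Compact open normal subgroups from reversible digraphs. -/

section Topology

variable {G : Type u} [Group G] [TopologicalSpace G] [IsTopologicalGroup G] {X : Type*}
  [MulAction G X] [Nonempty X] {R : X → X → Prop} {τ : X → X}

/-- At the first failure, fixing an `n`-path forces fixing everything, so the kernel of the action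
contains a finite intersection of open stabilizers. -/
lemma arcTransitive (h : IsReversibleDigraph G R τ)
    (hc : ∀ x : X, IsCompactOpen (stabilizer G x))
    (hN : ¬ ∃ N : Subgroup G, N.Normal ∧ IsCompactOpen N) (n : ℕ) : ArcTransitive G R n := by
  have := h.transitive
  induction n with
  | zero =>
    intro p q _ _
    obtain ⟨g, hg⟩ := exists_smul_eq G (p 0) (q 0)
    exact ⟨g, fun i hi => by obtain rfl := Nat.le_zero.mp hi; exact hg⟩
  | succ n ih =>
    by_contra hn
    have hfix : ∀ (k : G) (p : ℕ → X), IsArc R n p → (∀ i ≤ n, k • p i = p i) →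
        ∀ y, R (p n) y → k • y = y := by
      intro k p hp hk y hy
      by_contra hky
      exact hn (h.arcTransitive_succ ih hp hk hy hky)
    obtain ⟨x₀⟩ := ‹Nonempty X›
    obtain ⟨p, hp, -⟩ := h.exists_isArc x₀ n
    refine hN ⟨(MulAction.toPermHom G X).ker, inferInstance, ?_⟩
    have hle : (⨅ i : Fin (n + 1), stabilizer G (p i) : Subgroup G) ≤
        (MulAction.toPermHom G X).ker := by
      intro k hk
      rw [Subgroup.mem_iInf] at hk
      rw [MonoidHom.mem_ker]
      ext x
      exact h.smul_eq_of_forall_arc (hfix k) hp (fun i hi => hk ⟨i, by omega⟩) x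
    have ho : IsOpen ((⨅ i : Fin (n + 1), stabilizer G (p i) : Subgroup G) : Set G) := by
      rw [Subgroup.coe_iInf]
      exact isOpen_iInter_of_finite fun i => (hc _).2
    refine isCompactOpen_of_isOpen_of_subset (Subgroup.isOpen_mono hle ho) (hc x₀).1 ?_
    intro k hk
    exact congrArg (fun e : Equiv.Perm X => e x₀) (MonoidHom.mem_ker.mp hk)

/-- If `g` moves `x₀` to a successor, its powers trace a path; transitivity puts all endpoints of
`n`-paths in the orbit of `g ^ n • x₀`. -/
lemma exists_forall_ncard_arcEnds_le (h : IsReversibleDigraph G R τ)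
    (hT : ∀ n, ArcTransitive G R n) (hc : ∀ x : X, IsCompactOpen (stabilizer G x))
    (hu : IsUniscalar G) :
    ∃ M, ∀ n x, (arcEnds R n x).Finite ∧ (arcEnds R n x).ncard ≤ M := by
  have := h.transitive
  obtain ⟨x₀⟩ := ‹Nonempty X›
  obtain ⟨y, hy⟩ := h.exists_rel x₀
  obtain ⟨g, rfl⟩ := exists_smul_eq G x₀ y
  obtain ⟨M, hM⟩ := hu.exists_ncard_orbit_le hc g x₀
  refine ⟨M, fun n x => ?_⟩
  obtain ⟨a, rfl⟩ := exists_smul_eq G x₀ x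
  have hsub : arcEnds R n x₀ ⊆ orbit (stabilizer G x₀) (g ^ n • x₀) := by
    rintro _ ⟨q, hq, hq0, rfl⟩
    obtain ⟨k, hk⟩ := hT n _ q (h.isArc_pow_smul hy n) hq
    have hk0 := hk 0 (Nat.zero_le n)
    rw [pow_zero, one_smul, hq0] at hk0
    exact ⟨⟨k, hk0⟩, hk n le_rfl⟩
  rw [h.ncard_arcEnds_smul, h.arcEnds_smul]
  exact ⟨((hM n).1.subset hsub).image _,
    (Set.ncard_le_ncard hsub (hM n).1).trans (hM n).2⟩

/-- A uniscalar group without compact open normal subgroups does not act on a reversible digraph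
with compact open stabilizers. -/
theorem not_isUniscalar (h : IsReversibleDigraph G R τ)
    (hc : ∀ x : X, IsCompactOpen (stabilizer G x))
    (hN : ¬ ∃ N : Subgroup G, N.Normal ∧ IsCompactOpen N) : ¬ IsUniscalar G := by
  intro hu
  obtain ⟨M, hM⟩ := h.exists_forall_ncard_arcEnds_le (h.arcTransitive hc hN) hc hu
  obtain ⟨m, hm⟩ := h.exists_arcEnds_succ_eq hM
  obtain ⟨x₀⟩ := ‹Nonempty X›
  refine hN ⟨classKernel G R, h.classKernel_normal, ?_⟩
  -- Each set in this finite union is empty or a coset of the compact stabilizer of `x₀`.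
  have hcomp : IsCompact (⋃ y ∈ {y | eventualSetoid R y x₀}, {k : G | k • x₀ = y}) := by
    refine (h.finite_eventual_class hM x₀).isCompact_biUnion fun y _ => ?_
    by_cases hy : ∃ g : G, g • x₀ = y
    · obtain ⟨g, rfl⟩ := hy
      have e : {k : G | k • x₀ = g • x₀} = (g * ·) '' (stabilizer G x₀ : Set G) := by
        ext k
        constructor
        · intro hk
          refine ⟨g⁻¹ * k, ?_, mul_inv_cancel_left g k⟩
          rw [SetLike.mem_coe, mem_stabilizer_iff, mul_smul, hk, inv_smul_smul]
        · rintro ⟨l, hl, rfl⟩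
          rw [Set.mem_ofPred_eq, mul_smul, mem_stabilizer_iff.mp hl]
      rw [e]
      exact (hc x₀).1.image (continuous_const_mul g)
    · convert isCompact_empty
      exact Set.eq_empty_of_forall_notMem fun k hk => hy ⟨k, hk⟩
  refine isCompactOpen_of_isOpen_of_subset
    (Subgroup.isOpen_mono (h.stabilizer_le_classKernel hm x₀) (hc x₀).2) hcomp ?_
  intro k hk
  exact Set.mem_biUnion (hk x₀ : eventualSetoid R (k • x₀) x₀) rfl

end Topology

end IsReversibleDigraph

/-! ### Local actions on cubic Cayley–Abels graphs. -/

namespace IsCayleyAbelsGraph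

variable {G : Type u} [Group G] [TopologicalSpace G] {V : Type u} [MulAction G V]
  {Γ : SimpleGraph V}

lemma mem_of_forall_adj (h : IsCayleyAbelsGraph G Γ) {S : Set V} {v : V} (hv : v ∈ S)
    (hS : ∀ x ∈ S, ∀ y, Γ.Adj x y → y ∈ S) (w : V) : w ∈ S := by
  obtain ⟨p⟩ := h.connected.preconnected v w
  induction p with
  | nil => exact hv
  | cons hadj _ ih => exact ih (hS _ hv _ hadj)

/-- If vertex stabilizers fix all neighbours, then they are normal. -/
lemma normal_stabilizer_of_forall_adj (h : IsCayleyAbelsGraph G Γ) {v₀ : V}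
    (hfix : ∀ w, Γ.Adj v₀ w → stabilizer G v₀ ≤ stabilizer G w) : (stabilizer G v₀).Normal := by
  have := h.vertexTransitive
  have hfix' : ∀ v w, Γ.Adj v w → stabilizer G v ≤ stabilizer G w := by
    intro v w hvw k hk
    obtain ⟨g, rfl⟩ := exists_smul_eq G v₀ v
    have hw : Γ.Adj v₀ (g⁻¹ • w) := by simpa using h.adj_smul g⁻¹ _ _ hvw
    have hk' : g⁻¹ * k * g ∈ stabilizer G v₀ := by
      rw [mem_stabilizer_iff, mul_smul, mul_smul, mem_stabilizer_iff.mp hk, inv_smul_smul]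
    have := mem_stabilizer_iff.mp (hfix _ hw hk')
    rw [smul_smul, mul_inv_cancel_right, mul_smul] at this
    exact MulAction.injective _ this
  have hker : stabilizer G v₀ = (MulAction.toPermHom G V).ker := by
    ext k
    rw [MonoidHom.mem_ker]
    constructor
    · intro hk
      ext w
      exact h.mem_of_forall_adj (S := {w | k ∈ stabilizer G w}) hk
        (fun x hx y hxy => hfix' x y hxy hx) w
    · intro hk
      exact congrArg (fun e : Equiv.Perm V => e v₀) hk
  rw [hker]
  infer_instance

/-- The action on the arcs of a graph. -/
abbrev arcAction (h : IsCayleyAbelsGraph G Γ) : MulAction G {e : V × V // Γ.Adj e.1 e.2} where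
  smul g e := ⟨g • e.1, h.adj_smul g _ _ e.2⟩
  one_smul e := Subtype.ext (one_smul G e.1)
  mul_smul a b e := Subtype.ext (mul_smul a b e.1)

/-- The relation between consecutive arcs of a path without backtracking. -/
def Follows (Γ : SimpleGraph V) (e f : {e : V × V // Γ.Adj e.1 e.2}) : Prop :=
  e.1.2 = f.1.1 ∧ f.1.2 ≠ e.1.1

/-- The reversal of arcs. -/
def reversal (Γ : SimpleGraph V) (e : {e : V × V // Γ.Adj e.1 e.2}) :
    {e : V × V // Γ.Adj e.1 e.2} :=
  ⟨(e.1.2, e.1.1), e.2.symm⟩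

lemma isReversibleDigraph_follows (h : IsCayleyAbelsGraph G Γ)
    (h3 : ∀ v, (Γ.neighborSet v).ncard = 3) {v₀ : V}
    (htr : ∀ a b, Γ.Adj v₀ a → Γ.Adj v₀ b → ∃ g ∈ stabilizer G v₀, g • a = b) :
    letI := h.arcAction
    IsReversibleDigraph G (Follows Γ) (reversal Γ) := by
  let _ := h.arcAction
  have := h.vertexTransitive
  refine ⟨⟨?_⟩, ?_, ?_, fun _ _ => rfl, fun _ => rfl, ?_, ?_⟩
  · have hto : ∀ e : {e : V × V // Γ.Adj e.1 e.2}, ∃ g : G, g • e.1.1 = v₀ :=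
      fun e => exists_smul_eq G _ _
    intro e f
    obtain ⟨a, ha⟩ := hto e
    obtain ⟨b, hb⟩ := hto f
    obtain ⟨k, hk, hk'⟩ := htr (a • e.1.2) (b • f.1.2)
      (by rw [← ha]; exact h.adj_smul _ _ _ e.2) (by rw [← hb]; exact h.adj_smul _ _ _ f.2)
    refine ⟨b⁻¹ * k * a, Subtype.ext (Prod.ext ?_ ?_)⟩
    · change (b⁻¹ * k * a) • e.1.1 = f.1.1
      rw [mul_smul, mul_smul, ha, mem_stabilizer_iff.mp hk, ← hb, inv_smul_smul]
    · change (b⁻¹ * k * a) • e.1.2 = f.1.2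
      rw [mul_smul, mul_smul, hk', inv_smul_smul]
  · rintro g e f ⟨h1, h2⟩
    exact ⟨congrArg (g • ·) h1, fun h' => h2 (MulAction.injective g h')⟩
  · rintro ⟨⟨u, v⟩, huv⟩
    have hmem : u ∈ Γ.neighborSet v := huv.symm
    have hcard := Set.ncard_sdiff_singleton_of_mem hmem
    rw [h3] at hcard
    refine Eq.trans ?_ hcard
    refine Set.ncard_congr (fun f _ => f.1.2) ?_ ?_ ?_
    · rintro ⟨⟨a, b⟩, hab⟩ ⟨h1, h2⟩
      obtain rfl : v = a := h1
      exact ⟨hab, h2⟩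
    · rintro ⟨⟨a, b⟩, hab⟩ ⟨⟨c, d⟩, hcd⟩ ⟨h1, -⟩ ⟨h2, -⟩ (hbd : b = d)
      exact Subtype.ext (Prod.ext (h1.symm.trans h2) hbd)
    · rintro w ⟨hw, hne⟩
      exact ⟨⟨(v, w), hw⟩, ⟨rfl, hne⟩, rfl⟩
  · rintro e f ⟨h1, h2⟩
    exact ⟨h1.symm, h2.symm⟩
  · rintro S ⟨⟨⟨u, v⟩, huv⟩, he⟩ hrev hfol ⟨⟨a, b⟩, hab⟩
    -- Succession excludes only backtracking, and reversal supplies it.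
    have hstep : ∀ x y (hxy : Γ.Adj x y), (⟨(x, y), hxy⟩ : {e : V × V // Γ.Adj e.1 e.2}) ∈ S →
        ∀ z (hyz : Γ.Adj y z), (⟨(y, z), hyz⟩ : {e : V × V // Γ.Adj e.1 e.2}) ∈ S := by
      intro x y hxy hS z hyz
      by_cases hzx : z = x
      · subst hzx
        exact hrev _ hS
      · exact hfol _ hS _ ⟨rfl, hzx⟩
    exact h.mem_of_forall_adj
      (S := {x | ∀ z (hxz : Γ.Adj x z), (⟨(x, z), hxz⟩ : {e : V × V // Γ.Adj e.1 e.2}) ∈ S})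
      (hstep u v huv he) (fun x hx y hxy => hstep x y hxy (hx y hxy)) a b hab

/-- An arc crosses the matching edge at `x` and then leaves along one of the two other edges at `f
x`. -/
lemma isReversibleDigraph_matching (h : IsCayleyAbelsGraph G Γ)
    (h3 : ∀ v, (Γ.neighborSet v).ncard = 3) {f : V → V} (hadj : ∀ v, Γ.Adj v (f v))
    (hf : ∀ (g : G) v, f (g • v) = g • f v) (hff : ∀ v, f (f v) = v) :
    IsReversibleDigraph G (fun x y => Γ.Adj (f x) y ∧ y ≠ x) f := by
  refine ⟨h.vertexTransitive, ?_, ?_, hf, hff, ?_, ?_⟩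
  · rintro g x y ⟨h1, h2⟩
    exact ⟨by rw [hf]; exact h.adj_smul _ _ _ h1, fun h' => h2 (MulAction.injective g h')⟩
  · intro x
    have hmem : x ∈ Γ.neighborSet (f x) := (hadj x).symm
    have hcard := Set.ncard_sdiff_singleton_of_mem hmem
    rw [h3] at hcard
    exact hcard
  · rintro x y ⟨h1, h2⟩
    exact ⟨by rw [hff]; exact h1.symm, fun h' => h2 (by rw [← hff x, h', hff])⟩
  · rintro S ⟨v, hv⟩ hτ hR w
    refine h.mem_of_forall_adj hv (fun x hx y hxy => ?_) w
    by_cases hy : y = f x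
    · rw [hy]
      exact hτ x hx
    · exact hR _ (hτ x hx) y ⟨by rwa [hff], hy⟩

/-- Three points that form neither one orbit nor three split as two plus one. -/
lemma existsUnique_fixed_adj (h : IsCayleyAbelsGraph G Γ) {v₀ : V}
    (h3 : (Γ.neighborSet v₀).ncard = 3)
    (htr : ¬ ∀ a b, Γ.Adj v₀ a → Γ.Adj v₀ b → ∃ g ∈ stabilizer G v₀, g • a = b)
    (hfix : ¬ ∀ w, Γ.Adj v₀ w → stabilizer G v₀ ≤ stabilizer G w) :
    ∃! w, Γ.Adj v₀ w ∧ stabilizer G v₀ ≤ stabilizer G w := by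
  obtain ⟨a, b, c, hab, hac, hbc, hS⟩ := Set.ncard_eq_three.mp h3
  have hmem : ∀ w, Γ.Adj v₀ w ↔ w = a ∨ w = b ∨ w = c := fun w => by
    rw [← SimpleGraph.mem_neighborSet, hS]
    simp
  have hmv : ∀ g ∈ stabilizer G v₀, ∀ w, (w = a ∨ w = b ∨ w = c) →
      (g • w = a ∨ g • w = b ∨ g • w = c) := by
    intro g hg w hw
    rw [← hmem] at hw ⊢
    have := h.adj_smul g _ _ hw
    rwa [mem_stabilizer_iff.mp hg] at this
  have hle : ∀ w : V, stabilizer G v₀ ≤ stabilizer G w ↔ ∀ g ∈ stabilizer G v₀, g • w = w :=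
    fun _ => Iff.rfl
  have hinj : ∀ (g : G) (x y : V), g • x = g • y → x = y :=
    fun g _ _ => @MulAction.injective G V _ _ g _ _
  let O : V → V → Prop := fun x y => ∃ g ∈ stabilizer G v₀, g • x = y
  have htrans : ∀ x y z : V, O x y → O y z → O x z := by
    rintro x y z ⟨g, hg, rfl⟩ ⟨k, hk, rfl⟩
    exact ⟨k * g, mul_mem hk hg, mul_smul _ _ _⟩
  have hsymm : ∀ x y : V, O x y → O y x := by
    rintro x y ⟨g, hg, rfl⟩
    exact ⟨g⁻¹, inv_mem hg, inv_smul_smul _ _⟩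
  have hrefl : ∀ x : V, O x x := fun x => ⟨1, one_mem _, one_smul _ _⟩
  simp only [hmem, hle] at htr hfix ⊢
  refine existsUnique_of_exists_of_unique ?_ ?_
  · by_contra hno
    have hmoved : ∀ w, (w = a ∨ w = b ∨ w = c) → ∃ y, (y = a ∨ y = b ∨ y = c) ∧ y ≠ w ∧ O w y := by
      intro w hw
      by_contra hy
      exact hno ⟨w, hw, fun g hg => by_contra fun hne =>
        hy ⟨g • w, hmv g hg w hw, hne, g, hg, rfl⟩⟩
    obtain ⟨x, hx, hxa, hOx⟩ := hmoved a (by simp)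
    obtain ⟨y, hy, hyb, hOy⟩ := hmoved b (by simp)
    obtain ⟨z, hz, hzc, hOz⟩ := hmoved c (by simp)
    -- Without fixed points every orbit has at least two of the three points, so there is only one.
    have hOab : O a b ∧ O a c := by
      clear hno hmoved hmv htr hfix hle hmem hS hinj
      clear_value O
      grind
    refine htr fun u w hu hw => ?_
    have hOa : ∀ w, (w = a ∨ w = b ∨ w = c) → O a w := by
      rintro w (rfl | rfl | rfl)
      exacts [hrefl _, hOab.1, hOab.2]
    exact htrans _ _ _ (hsymm _ _ (hOa u hu)) (hOa w hw)
  · rintro x y ⟨hx, hxf⟩ ⟨hy, hyf⟩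
    by_contra hxy
    refine hfix fun w hw g hg => ?_
    have h1 := hmv g hg w hw
    have h2 := hxf g hg
    have h3 := hyf g hg
    have h4 := hinj g w x
    have h5 := hinj g w y
    clear hmv htr hfix hle hmem hS hxf hyf htrans hsymm hrefl
    grind

variable [IsTopologicalGroup G]

lemma isCompactOpen_stabilizer_arc (h : IsCayleyAbelsGraph G Γ)
    (e : {e : V × V // Γ.Adj e.1 e.2}) :
    letI := h.arcAction
    IsCompactOpen (stabilizer G e) := by
  let _ := h.arcAction
  have hst : (stabilizer G e : Set G) =
      (stabilizer G e.1.1 : Set G) ∩ (stabilizer G e.1.2 : Set G) := by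
    ext k
    change k • e = e ↔ k • e.1.1 = e.1.1 ∧ k • e.1.2 = e.1.2
    rw [Subtype.ext_iff, Prod.ext_iff]
    rfl
  refine isCompactOpen_of_isOpen_of_subset ?_ (h.stabilizer_compactOpen e.1.1).1 ?_
  · rw [hst]
    exact (h.stabilizer_compactOpen _).2.inter (h.stabilizer_compactOpen _).2
  · rw [hst]
    exact Set.inter_subset_left

theorem not_isUniscalar (h : IsCayleyAbelsGraph G Γ) (h3 : ∀ v, (Γ.neighborSet v).ncard = 3)
    (hN : ¬ ∃ N : Subgroup G, N.Normal ∧ IsCompactOpen N) : ¬ IsUniscalar G := by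
  intro hu
  have := h.vertexTransitive
  obtain ⟨v₀⟩ := h.connected.nonempty
  by_cases htr : ∀ a b, Γ.Adj v₀ a → Γ.Adj v₀ b → ∃ g ∈ stabilizer G v₀, g • a = b
  · let _ := h.arcAction
    have : Nonempty {e : V × V // Γ.Adj e.1 e.2} := by
      have hne : (Γ.neighborSet v₀).Nonempty :=
        Set.nonempty_of_ncard_ne_zero (by rw [h3]; omega)
      obtain ⟨w, hw⟩ := hne
      exact ⟨⟨(v₀, w), hw⟩⟩
    exact (h.isReversibleDigraph_follows h3 htr).not_isUniscalar
      h.isCompactOpen_stabilizer_arc hN hu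
  by_cases hfix : ∀ w, Γ.Adj v₀ w → stabilizer G v₀ ≤ stabilizer G w
  · exact hN ⟨_, h.normal_stabilizer_of_forall_adj hfix, h.stabilizer_compactOpen v₀⟩
  have hmove : ∀ (g : G) (v w : V), (Γ.Adj v w ∧ stabilizer G v ≤ stabilizer G w) →
      Γ.Adj (g • v) (g • w) ∧ stabilizer G (g • v) ≤ stabilizer G (g • w) := by
    rintro g v w ⟨h1, h2⟩
    refine ⟨h.adj_smul g _ _ h1, ?_⟩
    rw [stabilizer_smul_eq_stabilizer_map_conj, stabilizer_smul_eq_stabilizer_map_conj]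
    exact Subgroup.map_mono h2
  obtain ⟨w₀, hw₀, huniq₀⟩ := h.existsUnique_fixed_adj (h3 v₀) htr hfix
  have hex : ∀ v, ∃! w, Γ.Adj v w ∧ stabilizer G v ≤ stabilizer G w := by
    intro v
    obtain ⟨g, rfl⟩ := exists_smul_eq G v₀ v
    refine ⟨g • w₀, hmove g _ _ hw₀, fun w hw => ?_⟩
    rw [← inv_smul_eq_iff]
    apply huniq₀
    simpa using hmove g⁻¹ _ _ hw
  choose f hf huniq using hex
  have hsmul : ∀ (g : G) v, f (g • v) = g • f v :=
    fun g v => (huniq _ _ (hmove g _ _ (hf v))).symm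
  have hstab : ∀ v, stabilizer G (f v) ≤ stabilizer G v := by
    intro v
    have hle := (hf v).2
    -- The two stabilizers are conjugate, and uniscalarity forbids proper containment.
    obtain ⟨g, hg⟩ := exists_smul_eq G v (f v)
    rw [← hg, stabilizer_smul_eq_stabilizer_map_conj] at hle ⊢
    exact hu.map_conj_le (h.stabilizer_compactOpen v) hle
  have hff : ∀ v, f (f v) = v := fun v => (huniq _ _ ⟨(hf v).1.symm, hstab v⟩).symm
  have : Nonempty V := ⟨v₀⟩
  exact (h.isReversibleDigraph_matching h3 (fun v => (hf v).1) hsmul hff).not_isUniscalar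
    h.stabilizer_compactOpen hN hu

end IsCayleyAbelsGraph

end TDLC

theorem mainTheorem8 (G : Type u) [Group G] [TopologicalSpace G] [IsTopologicalGroup G]
    [LocallyCompactSpace G] [TotallyDisconnectedSpace G]
    (hG : TDLC.IsCompactlyGenerated G)
    (hN : ¬ ∃ N : Subgroup G, N.Normal ∧ TDLC.IsCompactOpen N)
    (hmv : TDLC.mv G = 3) :
    ¬ TDLC.IsUniscalar G := by
  -- An empty set of degrees would have infimum `0`, so the value `3` is attained by a graph.
  have hne : (TDLC.cayleyAbelsDegrees G).Nonempty := by
    by_contra he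
    rw [Set.not_nonempty_iff_eq_empty] at he
    rw [TDLC.mv, he, Nat.sInf_empty] at hmv
    omega
  obtain ⟨V, _, Γ, hΓ, hdeg⟩ := Nat.sInf_mem hne
  exact hΓ.not_isUniscalar (fun v => (hdeg v).trans hmv) hN
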